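/- **Setting.** Let $r\ge 1$ and let $\mathbf m=(m_1,\dots,m_r)\in\mathbb Z^r$ be a Motzkin path, i.e. $|m_\alpha-m_{\alpha+1}|\le 1$ for $1\le\alpha<r$. Let $K$ be a field, $t$ a formal variable, and $y_1,\dots,y_{2r+1}\in K$ skeleton weights with $y_{2j-1}\neq 0$ for $2\le j\le r$. **The graph $\Gamma_{\mathbf m}$.** It has $2r+2$ vertices, arranged in $r+1$ consecutive pairs $(J^-,J^+)$, $J=1,\dots,r+1$. The root $0$ is $1^-$ and the vertex $1$ is $1^+$. Call the pair $J$ *vertical* if $2\le J\le r$ and $m_J=m_{J-1}+1$, and *horizontal* otherwise. Put $J^*=J^+$ if $J=1$ or $J$ is vertical, and $J^*=J^-$ otherwise. The weighted oriented edges are: * $J^-\to J^+$ with weight $1$ and $J^+\to J^-$ with weight $t\,y_{2J-1}$, for $1\le J\le r+1$; * $J^*\to (J+1)^-$ with weight $1$ and $(J+1)^-\to J^*$ with weight $t\,y_{2J}$, for $1\le J\le r$; * $P^-\to Q^*$ with weight $t\,\dfrac{\prod_{j=Q}^{P-1}y_{2j}}{\prod_{j=Q+1}^{P-1}y_{2j-1}}$,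 for all $1\le Q$, $Q+2\le P\le r+1$ such that $m_{\alpha+1}=m_\alpha-1$ for $Q\le\alpha\le P-2$. (Equivalently, $\Gamma_{\mathbf m}$ is glued from one piece for each maximal descending segment of $\mathbf m$, along an edge which is horizontal or vertical according to whether the step of $\mathbf m$ between the two segments is flat or ascending.) **The compactified graph $\Gamma'_{\mathbf m}$.** It has the $r+1$ vertices $1,\dots,r+1$ and is obtained from $\Gamma_{\mathbf m}$ by identifying $J^-$ and $J^+$ to a vertex $J$ for each $J$, replacing the two edges between $J^-$ and $J^+$ by a loop at $J$ whose weight $t\,y_{2J-1}$ is the product of their weights, keeping all the other edges with their weights, and adding an ascending edge $I\to J$ with weight $(-1)^{J-I-1}$ whenever $I+2\le J$ and all the pairs $k$ with $I<k<J$ are vertical. **Transfer matrices.** Let $T_{\mathbf m}$ and $T'_{\mathbf m}$, of sizes $(2r+2)\times(2r+2)$ and $(r+1)\times(r+1)$, be the matrices over $K[[t]]$ whose entry in row $b$ and column $a$ is the weight of the edge $a\to b$ of $\Gamma_{\mathbf m}$, respectively $\Gamma'_{\mathbf m}$ (and $0$ if there is no such edge). **Theorem.** The matrices $1-T_{\mathbf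 m}$ and $1-T'_{\mathbf m}$ are invertible over $K[[t]]$, and $$\big((1-T_{\mathbf m})^{-1}\big)_{1,1}=\big((1-T'_{\mathbf m})^{-1}\big)_{1,1},$$ where the index $1$ on the left is the vertex $1=1^+$ of $\Gamma_{\mathbf m}$. The two sides are the ($t$-adically convergent) generating functions $\sum_{n\ge0}\sum_{(v_0,\dots,v_n)}\prod_{i<n}\mathrm{wt}(v_i\to v_{i+1})$ of the weighted paths, of arbitrary length $n$, from vertex $1$ to vertex $1$ on $\Gamma_{\mathbf m}$ and on $\Gamma'_{\mathbf m}$ respectively, so these generating functions coincide. In particular this holds for the weights attached to the $A_r$ $Q$-system: let $R_{\alpha,n}\in K$ ($0\le\alpha\le r+1$, $n\in\mathbb Z$) satisfy $R_{\alpha,n+1}R_{\alpha,n-1}=R_{\alpha,n}^2+R_{\alpha+1,n}R_{\alpha-1,n}$ for $1\le\alpha\le r$ and $R_{0,n}=R_{r+1,n}=1$, with all $R_{\alpha,n}\ne0$. Put $\lambda_{\alpha,n}=R_{\alpha,n+1}/R_{\alpha,n}$ and $\mu_{\alpha,n}=R_{\alpha,n}/R_{\alpha-1,n}$, and take $$y_{2\alpha-1}=\frac{\lambda_{\alpha,m_\alpha}}{\lambda_{\alpha-1,m_{\alpha-1}}}\quad(1\le\alpha\le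 r+1),\qquad y_{2\alpha}=\frac{\mu_{\alpha+1,m_\alpha+1}}{\mu_{\alpha,m_\alpha}}\,c_\alpha\,d_\alpha\quad(1\le\alpha\le r),$$ where $c_\alpha=\lambda_{\alpha+1,m_{\alpha+1}}/\lambda_{\alpha+1,m_\alpha}$ if $m_\alpha=m_{\alpha+1}+1$ and $c_\alpha=1$ otherwise, and $d_\alpha=\lambda_{\alpha-1,m_\alpha}/\lambda_{\alpha-1,m_{\alpha-1}}$ if $m_{\alpha-1}=m_\alpha+1$ and $d_\alpha=1$ otherwise (the values of $m_0$ and $m_{r+1}$ are immaterial, since $\lambda_{0,n}=\lambda_{r+1,n}=1$). -/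

import Mathlib

/-! ### Weighted oriented graphs, paths and transfer matrices

A weighted oriented graph on a vertex set `V` is given by `w : V → V → A`, where `w a b` is the
weight of the oriented edge `a → b`, and `w a b = 0` means that there is no such edge. -/

/-- The transfer matrix: the entry in row `b` and column `a` is the weight of the edge `a → b`. -/
def transferMatrix {V A : Type*} (w : V → V → A) : Matrix V V A :=
  Matrix.of fun b a => w a b

/-- The partition function of the paths `(v₀, v₁, …, vₙ)` of length `n` from `a` to `b`: the sum
over these paths of the products of the weights of the edges that they traverse. -/
def pathPartition {V A : Type*} [Fintype V] [DecidableEq V] [CommSemiring A]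
    (w : V → V → A) (a b : V) (n : ℕ) : A :=
  ∑ v : Fin (n + 1) → V with v 0 = a ∧ v (Fin.last n) = b,
    ∏ i : Fin n, w (v i.castSucc) (v i.succ)

/-- `Z` is the generating function of all paths (of arbitrary length) from `a` to `b`: the series
`∑ₙ pathPartition w a b n` of formal power series converges to `Z`, i.e. each coefficient of its
partial sums is eventually equal to that of `Z`. -/
def IsPathGenFun {V K : Type*} [Fintype V] [DecidableEq V] [CommSemiring K]
    (w : V → V → PowerSeries K) (a b : V) (Z : PowerSeries K) : Prop :=
  ∀ N : ℕ, ∀ᶠ L : ℕ in Filter.atTop,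
    PowerSeries.coeff N (∑ n ∈ Finset.range L, pathPartition w a b n) = PowerSeries.coeff N Z

/-! ### Motzkin paths -/

/-- `(m 1, …, m r)` is a Motzkin path (the other values of `m` play no role). -/
def IsMotzkinPath (r : ℕ) (m : ℕ → ℤ) : Prop :=
  ∀ α : ℕ, 1 ≤ α → α + 1 ≤ r → |m α - m (α + 1)| ≤ 1

/-- `m a, m (a+1), …, m b` is descending (by one at every step), i.e. `a, …, b` belong to the same
maximal descending segment of the Motzkin path. -/
def IsDescending (m : ℕ → ℤ) (a b : ℕ) : Prop :=
  ∀ α : ℕ, a ≤ α → α + 1 ≤ b → m (α + 1) = m α - 1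

/-! ### The graph `Γ_m`

The `2r+2` vertices of `Γ_m`, in the order `i < i' < i+1` from the root upwards, are arranged in
`r+1` consecutive pairs `J = 1, …, r+1`, joined by the skeleton edges `1, 3, …, 2r+1`.  The vertex
`(j, false)` is the lower (first) one and `(j, true)` is the upper (second) one of the pair
`J = j + 1`.  Thus the root `0` is `(0, false)`, and the vertex `1` is `(0, true)`. -/

abbrev GammaVertex (r : ℕ) : Type := Fin (r + 1) × Bool

/-- The vertex labelled `1` of `Γ_m`. -/
def gammaOne (r : ℕ) : GammaVertex r := (0, true)

/-- The skeleton edge `2J-1`, joining the two vertices of the pair `J`, is vertical: it is the edge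
along which two consecutive descending segments, ending at `J-1` and starting at `J`, with
an ascending separation are glued.  All the other edges `2J-1` are horizontal: they are the edge
from `0` to `1`, the top edge, and the edges joining some `i` and `i'`. -/
def IsVerticalPair (r : ℕ) (m : ℕ → ℤ) (J : ℕ) : Prop :=
  2 ≤ J ∧ J ≤ r ∧ m J = m (J - 1) + 1

open Classical in
/-- The vertex of the pair `J` to which the skeleton edge `2J` (going up to the lower vertex of the
pair `J+1`) is attached: the vertex `1` if `J = 1`, the upper vertex if the pair is vertical, and
the unprimed vertex `i` if the pair is the horizontal pair `i, i'`. -/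
noncomputable def exitSide (r : ℕ) (m : ℕ → ℤ) (J : ℕ) : Bool :=
  if J = 1 ∨ IsVerticalPair r m J then true else false

/-- The weight of the extra down-pointing edge from (the lower vertex of) the pair `P` to (the exit
vertex of) the pair `Q`, in terms of the skeleton weights `y 1, …, y (2r+1)`. -/
def extraWeight {K : Type*} [Field K] (y : ℕ → K) (P Q : ℕ) : K :=
  (∏ j ∈ Finset.Ico Q P, y (2 * j)) / ∏ j ∈ Finset.Ioo Q P, y (2 * j - 1)

open Classical in
/-- The weighted graph `Γ_m` with skeleton weights `t y_1, …, t y_{2r+1}`, where `t` is the formal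
variable of the power series ring. The edges pointing away from the root have weight `1`. -/
noncomputable def gammaGraph {K : Type*} [Field K] (r : ℕ) (m : ℕ → ℤ) (y : ℕ → K)
    (u v : GammaVertex r) : PowerSeries K :=
  let I : ℕ := u.1 + 1
  let J : ℕ := v.1 + 1
  if I = J ∧ u.2 = false ∧ v.2 = true then
    -- skeleton edge `2I-1`, away from the root
    1
  else if I = J ∧ u.2 = true ∧ v.2 = false then
    -- skeleton edge `2I-1`, towards the root
    PowerSeries.X * PowerSeries.C (y (2 * I - 1))
  else if J = I + 1 ∧ u.2 = exitSide r m I ∧ v.2 = false then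
    -- skeleton edge `2I`, away from the root
    1
  else if I = J + 1 ∧ u.2 = false ∧ v.2 = exitSide r m J then
    -- skeleton edge `2J`, towards the root
    PowerSeries.X * PowerSeries.C (y (2 * J))
  else if J + 2 ≤ I ∧ IsDescending m J (I - 1) ∧ u.2 = false ∧ v.2 = exitSide r m J then
    -- extra down-pointing edge inside the piece of a descending segment
    PowerSeries.X * PowerSeries.C (extraWeight y I J)
  else 0

/-! ### The compactified graph `Γ'_m` -/

open Classical in
/-- The network of ascending edges which is added to a maximal vertical chain of `Γ_m` when its
vertical pairs are contracted: an edge `I → J` of weight `(-1)^(J-I-1)` whenever `I + 2 ≤ J`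
and all the pairs strictly between `I` and `J` are vertical. -/
noncomputable def ascendingWeight (A : Type*) [Ring A] (r : ℕ) (m : ℕ → ℤ) (I J : ℕ) : A :=
  if I + 2 ≤ J ∧ ∀ k : ℕ, I < k → k < J → IsVerticalPair r m k then (-1) ^ (J - I - 1) else 0

/-- The compactified graph `Γ'_m` on the vertices `1, …, r+1` (with `i : Fin (r+1)` standing for
the vertex `i + 1`), built from `Γ_m`: the two vertices of each pair are identified, the
double edge joining them becomes a loop weighted by the product of the two weights, the other edges
and their weights are kept, and the ascending edges of the vertical chains are added. -/
noncomputable def compactGraph {K : Type*} [Field K] (r : ℕ) (m : ℕ → ℤ) (y : ℕ → K)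
    (i j : Fin (r + 1)) : PowerSeries K :=
  if i = j then
    gammaGraph r m y (i, false) (i, true) * gammaGraph r m y (i, true) (i, false)
  else
    (∑ a : Bool, ∑ b : Bool, gammaGraph r m y (i, a) (j, b)) +
      ascendingWeight (PowerSeries K) r m (i + 1) (j + 1)

/-! ### The `Q`-system and the skeleton weights -/

/-- `R α n`, for `0 ≤ α ≤ r + 1` and `n : ℤ`, is a solution of the `A_r` `Q`-system. -/
structure IsQSystemSolution {K : Type*} [Field K] (r : ℕ) (R : ℕ → ℤ → K) : Prop where
  recursion : ∀ (α : ℕ) (n : ℤ), 1 ≤ α → α ≤ r →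
    R α (n + 1) * R α (n - 1) = R α n ^ 2 + R (α + 1) n * R (α - 1) n
  bottom : ∀ n : ℤ, R 0 n = 1
  top : ∀ n : ℤ, R (r + 1) n = 1

def lam {K : Type*} [Field K] (R : ℕ → ℤ → K) (α : ℕ) (n : ℤ) : K :=
  R α (n + 1) / R α n

def mu {K : Type*} [Field K] (R : ℕ → ℤ → K) (α : ℕ) (n : ℤ) : K :=
  R α n / R (α - 1) n

/-- The skeleton weight `y_{2α-1}(m)`, `α = 1, …, r+1`. -/
def oddWeight {K : Type*} [Field K] (R : ℕ → ℤ → K) (m : ℕ → ℤ) (α : ℕ) : K :=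
  lam R α (m α) / lam R (α - 1) (m (α - 1))

/-- The skeleton weight `y_{2α}(m)`, `α = 1, …, r`. -/
def evenWeight {K : Type*} [Field K] (R : ℕ → ℤ → K) (m : ℕ → ℤ) (α : ℕ) : K :=
  mu R (α + 1) (m α + 1) / mu R α (m α) *
    (if m α = m (α + 1) + 1 then lam R (α + 1) (m (α + 1)) / lam R (α + 1) (m α) else 1) *
    (if m (α - 1) = m α + 1 then lam R (α - 1) (m α) / lam R (α - 1) (m (α - 1)) else 1)

/-- The skeleton weights `y_1(m), …, y_{2r+1}(m)`. -/
def skeletonWeight {K : Type*} [Field K] (R : ℕ → ℤ → K) (m : ℕ → ℤ) (i : ℕ) : K :=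
  if i % 2 = 1 then oddWeight R m ((i + 1) / 2) else evenWeight R m (i / 2)

/-! ### Equality of path generating functions -/

/-- For the skeleton weights `y`: with `T` and `T'` the transfer matrices of `Γ_m` and `Γ'_m`, the
matrices `1 - T` and `1 - T'` are invertible over the formal power series in `t`, the entries
`(1,1)` of their inverses agree, and these entries are the generating functions of the paths from
the vertex `1` to itself on the two graphs. -/
def CompactificationPreservesPaths {K : Type*} [Field K] (r : ℕ) (m : ℕ → ℤ) (y : ℕ → K) : Prop :=
  IsUnit (1 - transferMatrix (gammaGraph r m y)) ∧
  IsUnit (1 - transferMatrix (compactGraph r m y)) ∧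
  (1 - transferMatrix (gammaGraph r m y))⁻¹ (gammaOne r) (gammaOne r) =
    (1 - transferMatrix (compactGraph r m y))⁻¹ 0 0 ∧
  IsPathGenFun (gammaGraph r m y) (gammaOne r) (gammaOne r)
    ((1 - transferMatrix (gammaGraph r m y))⁻¹ (gammaOne r) (gammaOne r)) ∧
  IsPathGenFun (compactGraph r m y) 0 0
    ((1 - transferMatrix (compactGraph r m y))⁻¹ 0 0)

/-! ### Path generating functions and transfer matrices -/

/-! Both generating functions are entries of solutions of linear systems (last-step decompositions),
and a solution `x` for `Γ_m` can be rescaled into the unique solution for `Γ'_m`. The value at a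
pair `J ≥ 2` is `x (J⁻)` times the loop weights of all vertical pairs strictly below `J`; at the
bottom pair it is `x (1⁺)`, so the two `(1,1)` entries agree.

At a vertical pair, `x (J⁻) = loop * x (J⁺) + arrival`. Subtracting the arrivals from below thus
leaves `loop * x (J⁺)`, the rescaled weight going up to `J + 1`. Iterating this subtraction along a
vertical chain produces the signed ascending edges (`chainWeight_succ`, `sum_chainWeight`). A
down-pointing edge never passes over a vertical pair, so the rescaling factors at its two ends
differ at most by the loop at its target (`descendingWeight_mul_verticalLoopProduct`).

The rescaling factors may be divisible by `t`, so the transport goes from `Γ_m` to `Γ'_m` and relies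
on uniqueness for `Γ'_m`. -/

theorem pathPartition_succ {V A : Type*} [Fintype V] [DecidableEq V] [CommSemiring A]
    (w : V → V → A) (a b : V) (n : ℕ) :
    pathPartition w a b (n + 1) = ∑ c, w a c * pathPartition w c b n := by
  simp only [pathPartition, Finset.sum_filter, Finset.mul_sum]
  rw [← (Fin.consEquiv fun _ : Fin (n + 2) => V).sum_comp, Fintype.sum_prod_type,
    Finset.sum_comm]
  simp only [Fin.consEquiv_apply]
  rw [Finset.sum_comm (s := (Finset.univ : Finset V))]
  refine Finset.sum_congr rfl fun v _ => ?_
  -- With the tail `v` fixed, the prepended vertex must be `a` on the left, and the intermediate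
  -- vertex `c` must be `v 0` on the right.
  rw [Finset.sum_eq_single a, Finset.sum_eq_single (v 0)]
  · simp [← Fin.succ_last, Fin.prod_univ_succ]
  · intro c _ hc
    simp [hc.symm]
  · simp
  · intro c _ hc
    simp [hc]
  · simp

theorem pathPartition_eq_pow {V A : Type*} [Fintype V] [DecidableEq V] [CommSemiring A]
    (w : V → V → A) (a b : V) (n : ℕ) :
    pathPartition w a b n = (transferMatrix w ^ n) b a := by
  induction n generalizing a with
  | zero =>
    rw [pow_zero, Matrix.one_apply, pathPartition, Finset.sum_filter,
      ← (Equiv.funUnique (Fin 1) V).symm.sum_comp]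
    rw [Finset.sum_eq_single a]
    · simp [eq_comm]
    · intro c _ hc
      simp [hc]
    · simp
  | succ n ih =>
    rw [pathPartition_succ, pow_succ, Matrix.mul_apply]
    exact Finset.sum_congr rfl fun c _ => by rw [ih, mul_comm]; rfl

/-- If the edges that do not vanish at `t = 0` strictly increase a rank function, then the transfer
matrix is nilpotent at `t = 0`. -/
theorem pow_apply_eq_zero_of_rank {V K : Type*} [Fintype V] [DecidableEq V] [CommSemiring K]
    (M : Matrix V V K) (ρ : V → ℕ) (h : ∀ a b, M b a ≠ 0 → ρ a < ρ b) (n : ℕ) (a b : V)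
    (hn : ρ b < ρ a + n) : (M ^ n) b a = 0 := by
  induction n generalizing a with
  | zero =>
    rw [pow_zero, Matrix.one_apply_ne]
    rintro rfl
    omega
  | succ n ih =>
    rw [pow_succ, Matrix.mul_apply]
    refine Finset.sum_eq_zero fun c _ => ?_
    by_cases hc : M c a = 0
    · rw [hc, mul_zero]
    · have := h a c hc
      rw [ih c (by omega), zero_mul]

theorem exists_constantCoeff_transferMatrix_pow_eq_zero {V K : Type*} [Fintype V] [DecidableEq V]
    [CommRing K] (w : V → V → PowerSeries K) (ρ : V → ℕ)
    (h : ∀ a b, PowerSeries.constantCoeff (w a b) ≠ 0 → ρ a < ρ b) :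
    ∃ n, (transferMatrix w ^ n).map (PowerSeries.constantCoeff (R := K)) = 0 := by
  -- More strictly increasing steps than the maximal rank allows.
  refine ⟨Finset.univ.sup ρ + 1, ?_⟩
  rw [Matrix.map_pow]
  ext b a
  refine pow_apply_eq_zero_of_rank _ ρ h _ a b ?_
  have := Finset.le_sup (f := ρ) (Finset.mem_univ b)
  omega

/-- Invertibility can be tested on the determinant at `t = 0`, where the matrix is `1` minus a
nilpotent. -/
theorem isUnit_one_sub_transferMatrix {V K : Type*} [Fintype V] [DecidableEq V]
    [CommRing K] (w : V → V → PowerSeries K) (ρ : V → ℕ)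
    (h : ∀ a b, PowerSeries.constantCoeff (w a b) ≠ 0 → ρ a < ρ b) :
    IsUnit (1 - transferMatrix w) := by
  obtain ⟨n, hn⟩ := exists_constantCoeff_transferMatrix_pow_eq_zero w ρ h
  rw [Matrix.isUnit_iff_isUnit_det, PowerSeries.isUnit_iff_constantCoeff, RingHom.map_det,
    ← Matrix.isUnit_iff_isUnit_det, map_sub, map_one]
  refine IsNilpotent.isUnit_one_sub ⟨n, ?_⟩
  rw [← map_pow]
  exact hn

/-- Some power `T ^ k` is divisible by `t`, so the tail of the geometric series from `k * (N + 1)`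
on is divisible by `t ^ (N + 1)` and does not affect the coefficient of order `N`. -/
theorem isPathGenFun_inv_one_sub {V K : Type*} [Fintype V] [DecidableEq V]
    [CommRing K] (w : V → V → PowerSeries K) (ρ : V → ℕ)
    (h : ∀ a b, PowerSeries.constantCoeff (w a b) ≠ 0 → ρ a < ρ b) (a b : V) :
    IsPathGenFun w a b ((1 - transferMatrix w)⁻¹ b a) := by
  have hu := isUnit_one_sub_transferMatrix w ρ h
  obtain ⟨k, hk⟩ := exists_constantCoeff_transferMatrix_pow_eq_zero w ρ h
  set T := transferMatrix w with hT
  obtain ⟨B, hB⟩ : ∃ B : Matrix V V (PowerSeries K),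
      T ^ k = (PowerSeries.X : PowerSeries K) • B := by
    have hd : ∀ i j, ∃ c, (T ^ k) i j = PowerSeries.X * c := fun i j =>
      PowerSeries.X_dvd_iff.2 (congrFun (congrFun hk i) j)
    choose c hc using hd
    exact ⟨Matrix.of c, by ext1 i j; exact hc i j⟩
  intro N
  filter_upwards [Filter.eventually_ge_atTop (k * (N + 1))] with L hL
  obtain ⟨l, rfl⟩ := Nat.exists_eq_add_of_le hL
  have hpow : T ^ (k * (N + 1) + l) =
      (PowerSeries.X ^ (N + 1) : PowerSeries K) • (B ^ (N + 1) * T ^ l) := by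
    rw [pow_add, pow_mul, hB, smul_pow, Matrix.smul_mul]
  have hsum : ∑ n ∈ Finset.range (k * (N + 1) + l), T ^ n =
      (1 - T)⁻¹ - (PowerSeries.X ^ (N + 1) : PowerSeries K) •
        ((1 - T)⁻¹ * (B ^ (N + 1) * T ^ l)) := by
    have hdet := (Matrix.isUnit_iff_isUnit_det _).1 hu
    have hg := mul_neg_geom_sum T (k * (N + 1) + l)
    rw [← Matrix.nonsing_inv_mul_cancel_left (A := 1 - T)
      (∑ n ∈ Finset.range (k * (N + 1) + l), T ^ n) hdet, hg, hpow, mul_sub, mul_one,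
      Matrix.mul_smul]
  simp only [pathPartition_eq_pow, ← hT]
  rw [← Matrix.sum_apply, hsum, Matrix.sub_apply, map_sub, Matrix.smul_apply, smul_eq_mul,
    PowerSeries.coeff_X_pow_mul', if_neg (by omega), sub_zero]

/-- The generating functions of the paths from `a` satisfy the linear system of last-step
decompositions. -/
theorem inv_one_sub_transferMatrix_apply {V A : Type*} [Fintype V] [DecidableEq V] [CommRing A]
    (w : V → V → A) (hu : IsUnit (1 - transferMatrix w)) (a b : V) :
    (1 - transferMatrix w)⁻¹ b a =
      ∑ c, w c b * (1 - transferMatrix w)⁻¹ c a + if b = a then 1 else 0 := by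
  have h := Matrix.mul_nonsing_inv _ ((Matrix.isUnit_iff_isUnit_det _).1 hu)
  rw [sub_mul, one_mul, sub_eq_iff_eq_add] at h
  have h' := congrFun (congrFun h b) a
  rw [Matrix.add_apply, Matrix.mul_apply, Matrix.one_apply] at h'
  rw [h', add_comm]
  rfl

/-- The linear system of last-step decompositions determines the generating functions. -/
theorem inv_one_sub_transferMatrix_apply_eq {V A : Type*} [Fintype V] [DecidableEq V]
    [CommRing A] (w : V → V → A) (hu : IsUnit (1 - transferMatrix w)) (a : V) (z : V → A)
    (hz : ∀ b, z b = ∑ c, w c b * z c + if b = a then 1 else 0) (b : V) :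
    (1 - transferMatrix w)⁻¹ b a = z b := by
  have h : (1 - transferMatrix w).mulVec z = Pi.single a 1 := by
    ext1 b
    rw [Matrix.sub_mulVec, Matrix.one_mulVec, Pi.sub_apply, hz b, Pi.single_apply,
      sub_eq_iff_eq_add, add_comm]
    rfl
  have h2 : z = (1 - transferMatrix w)⁻¹.mulVec (Pi.single a 1) := by
    rw [← h, Matrix.mulVec_mulVec, Matrix.nonsing_inv_mul _
      ((Matrix.isUnit_iff_isUnit_det _).1 hu), Matrix.one_mulVec]
  rw [h2, Matrix.mulVec_single_one]
  rfl

/-! ### The edges of `Γ_m` and `Γ'_m` -/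

open Classical in
/-- The weight of the down-pointing edge from the pair `P` to the pair `Q` of `Γ_m`. -/
noncomputable def descendingWeight {K : Type*} [Field K] (m : ℕ → ℤ) (y : ℕ → K) (P Q : ℕ) :
    PowerSeries K :=
  if P = Q + 1 then PowerSeries.X * PowerSeries.C (y (2 * Q))
  else if Q + 2 ≤ P ∧ IsDescending m Q (P - 1) then
    PowerSeries.X * PowerSeries.C (extraWeight y P Q)
  else 0

theorem descendingWeight_of_le {K : Type*} [Field K] (m : ℕ → ℤ) (y : ℕ → K) {P Q : ℕ}
    (h : P ≤ Q) : descendingWeight m y P Q = 0 := by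
  rw [descendingWeight, if_neg (by omega), if_neg (by omega)]

theorem constantCoeff_descendingWeight {K : Type*} [Field K] (m : ℕ → ℤ) (y : ℕ → K) (P Q : ℕ) :
    PowerSeries.constantCoeff (descendingWeight m y P Q) = 0 := by
  unfold descendingWeight
  split_ifs <;> simp

/-- No down-pointing edge passes over a vertical pair. -/
theorem not_isVerticalPair_of_descendingWeight_ne_zero {K : Type*} [Field K] {r : ℕ}
    {m : ℕ → ℤ} {y : ℕ → K} {P Q k : ℕ} (h : descendingWeight m y P Q ≠ 0) (hQ : Q < k)
    (hP : k < P) : ¬ IsVerticalPair r m k := by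
  rintro ⟨_, _, hk⟩
  rw [descendingWeight, if_neg (by omega)] at h
  split_ifs at h with hc
  -- The step from `k - 1` to `k` would be both descending and ascending.
  · have hd := hc.2 (k - 1) (by omega) (by omega)
    rw [show k - 1 + 1 = k by omega] at hd
    omega
  · exact h rfl

/-- The edge types are mutually exclusive, so the cascade of cases is a sum, which can be summed
over termwise. -/
theorem gammaGraph_apply {K : Type*} [Field K] (r : ℕ) (m : ℕ → ℤ) (y : ℕ → K)
    (i j : Fin (r + 1)) (a b : Bool) :
    gammaGraph r m y (i, a) (j, b) =
      (if i = j ∧ a = false ∧ b = true then 1 else 0) +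
      (if i = j ∧ a = true ∧ b = false then
        PowerSeries.X * PowerSeries.C (y (2 * ((j : ℕ) + 1) - 1)) else 0) +
      (if (j : ℕ) = i + 1 ∧ a = exitSide r m (i + 1) ∧ b = false then 1 else 0) +
      (if a = false ∧ b = exitSide r m (j + 1) then
        descendingWeight m y (i + 1) (j + 1) else 0) := by
  simp only [gammaGraph, Nat.add_right_cancel_iff, Fin.val_inj]
  rcases lt_trichotomy i j with h | rfl | h
  · have h1 : (i : ℕ) < j := h
    rw [descendingWeight_of_le m y (by omega)]
    simp only [h.ne, false_and, if_false, ite_self, add_zero, zero_add]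
    rw [if_neg (c := (i : ℕ) = j + 1 ∧ _) (by omega),
      if_neg (c := (j : ℕ) + 1 + 2 ≤ _ ∧ _) (by omega)]
  · rw [descendingWeight_of_le m y le_rfl]
    cases a <;> cases b <;> simp
  · have h1 : (j : ℕ) < i := h
    simp only [h.ne', false_and, if_false, zero_add]
    rw [if_neg (c := (j : ℕ) = i + 1 ∧ _) (by omega),
      if_neg (c := (j : ℕ) = i + 1 ∧ _) (by omega), zero_add, descendingWeight]
    simp only [Nat.add_right_cancel_iff, Nat.add_sub_cancel]
    by_cases hab : a = false ∧ b = exitSide r m (j + 1)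
    · obtain ⟨rfl, rfl⟩ := hab
      simp only
      split_ifs <;> first | rfl | tauto
    · simp only [hab, and_false, if_false]

open Classical in
/-- The weight of the ascending edge from the pair `I` to the pair `J` of `Γ'_m`, skeleton edges
included. -/
noncomputable def chainWeight (A : Type*) [Ring A] (r : ℕ) (m : ℕ → ℤ) (I J : ℕ) : A :=
  (if J = I + 1 then 1 else 0) + ascendingWeight A r m I J

theorem chainWeight_of_le {A : Type*} [Ring A] {r : ℕ} {m : ℕ → ℤ} {I J : ℕ} (h : J ≤ I) :
    chainWeight A r m I J = 0 := by
  rw [chainWeight, ascendingWeight, if_neg (by omega), if_neg (by omega), add_zero]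

open Classical in
-- An edge from below `J` to `J + 1` passes over `J`: it exists only if `J` is vertical, and it then
-- prolongs an edge ending at `J` with the opposite sign.
theorem chainWeight_succ {A : Type*} [Ring A] (r : ℕ) (m : ℕ → ℤ) (I J : ℕ) :
    chainWeight A r m I (J + 1) =
      (if I = J then 1 else 0) - if IsVerticalPair r m J then chainWeight A r m I J else 0 := by
  rcases lt_trichotomy I J with h | rfl | h
  · rw [if_neg h.ne, chainWeight, if_neg (by omega), zero_add, zero_sub, ascendingWeight]
    by_cases hv : IsVerticalPair r m J
    · rw [if_pos hv, chainWeight, ascendingWeight]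
      rcases eq_or_ne J (I + 1) with rfl | hJ
      · rw [if_pos, if_pos rfl, if_neg (by omega)]
        · simp [show I + 1 + 1 - I - 1 = 1 by omega]
        · refine ⟨by omega, fun k h1 h2 => ?_⟩
          rwa [show k = I + 1 by omega]
      · rw [if_neg hJ, zero_add]
        by_cases hc : ∀ k, I < k → k < J → IsVerticalPair r m k
        · rw [if_pos, if_pos ⟨by omega, hc⟩, show J + 1 - I - 1 = J - I - 1 + 1 by omega,
            pow_succ, mul_neg_one]
          refine ⟨by omega, fun k h1 h2 => ?_⟩
          rcases eq_or_ne k J with rfl | hk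
          · exact hv
          · exact hc k h1 (by omega)
        · rw [if_neg fun h' => hc fun k h1 h2 => h'.2 k h1 (by omega),
            if_neg fun h' => hc h'.2, neg_zero]
    · rw [if_neg hv, neg_zero, if_neg fun h' => hv (h'.2 J h (by omega))]
  · rw [chainWeight_of_le le_rfl, ite_self, chainWeight, ascendingWeight]
    simp
  · rw [chainWeight_of_le h, chainWeight_of_le h.le, if_neg h.ne']
    simp

theorem compactGraph_apply {K : Type*} [Field K] (r : ℕ) (m : ℕ → ℤ) (y : ℕ → K)
    (i j : Fin (r + 1)) :
    compactGraph r m y i j =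
      (if i = j then PowerSeries.X * PowerSeries.C (y (2 * ((j : ℕ) + 1) - 1)) else 0) +
      chainWeight (PowerSeries K) r m (i + 1) (j + 1) +
      descendingWeight m y (i + 1) (j + 1) := by
  unfold compactGraph
  split_ifs with h
  · subst h
    simp only [gammaGraph_apply, descendingWeight_of_le m y le_rfl, chainWeight_of_le le_rfl]
    simp
  · simp only [gammaGraph_apply, chainWeight, h, false_and, if_false, Fintype.sum_bool,
      Nat.add_right_cancel_iff]
    cases exitSide r m (i + 1) <;> cases exitSide r m (j + 1) <;> simp <;> ring

/-- The rank lists the vertices as `1⁻, 1⁺, 2⁻, 2⁺, …`; only edges pointing away from the root lack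
a factor `t`. -/
theorem rank_lt_of_constantCoeff_gammaGraph_ne_zero {K : Type*} [Field K] (r : ℕ) (m : ℕ → ℤ)
    (y : ℕ → K) (u v : GammaVertex r)
    (h : PowerSeries.constantCoeff (gammaGraph r m y u v) ≠ 0) :
    2 * (u.1 : ℕ) + u.2.toNat < 2 * (v.1 : ℕ) + v.2.toNat := by
  obtain ⟨i, a⟩ := u
  obtain ⟨j, b⟩ := v
  contrapose! h
  rw [gammaGraph_apply, if_neg, if_neg (c := (j : ℕ) = i + 1 ∧ _)]
  · simp only [map_add, map_zero, zero_add, add_zero, apply_ite PowerSeries.constantCoeff,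
      constantCoeff_descendingWeight]
    simp
  · rintro ⟨h1, -, rfl⟩
    have := a.toNat_le
    simp only [Bool.toNat_false] at h
    omega
  · rintro ⟨rfl, rfl, rfl⟩
    simp at h

theorem lt_of_constantCoeff_compactGraph_ne_zero {K : Type*} [Field K] (r : ℕ) (m : ℕ → ℤ)
    (y : ℕ → K) (i j : Fin (r + 1))
    (h : PowerSeries.constantCoeff (compactGraph r m y i j) ≠ 0) : (i : ℕ) < j := by
  contrapose! h
  rw [compactGraph_apply, chainWeight_of_le (by omega)]
  simp [apply_ite, constantCoeff_descendingWeight]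

/-! ### Comparison of the two linear systems -/

section Comparison

variable {K : Type*} [Field K] (r : ℕ) (m : ℕ → ℤ) (y : ℕ → K)

open Classical in
/-- The product of the weights of the loops at the vertical pairs below `n + 1`. -/
noncomputable def verticalLoopProduct (n : ℕ) : PowerSeries K :=
  ∏ k ∈ Finset.range n,
    if IsVerticalPair r m (k + 1) then PowerSeries.X * PowerSeries.C (y (2 * (k + 1) - 1)) else 1

open Classical in
theorem descendingWeight_mul_verticalLoopProduct (p q : ℕ) :
    descendingWeight m y (p + 1) (q + 1) * verticalLoopProduct r m y p =
      verticalLoopProduct r m y q * (if IsVerticalPair r m (q + 1) then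
        PowerSeries.X * PowerSeries.C (y (2 * (q + 1) - 1)) else 1) *
        descendingWeight m y (p + 1) (q + 1) := by
  by_cases h : descendingWeight m y (p + 1) (q + 1) = 0
  · simp [h]
  have hqp : q + 1 ≤ p := by
    by_contra hc
    exact h (descendingWeight_of_le m y (by omega))
  rw [mul_comm]
  congr 1
  -- The index `k` stands for the pair `k + 1`, so the interval from `q + 1` to `p` covers exactly
  -- the pairs strictly between source and target.
  rw [verticalLoopProduct, ← Finset.prod_range_mul_prod_Ico _ hqp, Finset.prod_range_succ,
    verticalLoopProduct]
  rw [Finset.prod_eq_one (s := Finset.Ico _ _), mul_one]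
  intro k hk
  rw [Finset.mem_Ico] at hk
  rw [if_neg (not_isVerticalPair_of_descendingWeight_ne_zero h (by omega) (by omega))]

/-- `x` solves the linear system of the path generating functions of `Γ_m` from the vertex `1`. -/
def IsGammaSolution (x : GammaVertex r → PowerSeries K) : Prop :=
  ∀ v, x v = ∑ u, gammaGraph r m y u v * x u + if v = gammaOne r then 1 else 0

variable {r} in
/-- The total weight with which the pair `j + 1` is reached from its predecessor. -/
noncomputable def arrival (x : GammaVertex r → PowerSeries K) (j : Fin (r + 1)) :
    PowerSeries K :=
  ∑ i : Fin (r + 1), if (j : ℕ) = i + 1 then x (i, exitSide r m (i + 1)) else 0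

variable {r} in
/-- The total weight with which the pair `j + 1` is reached from the pairs above it. -/
noncomputable def descent (x : GammaVertex r → PowerSeries K) (j : Fin (r + 1)) :
    PowerSeries K :=
  ∑ i : Fin (r + 1), descendingWeight m y (i + 1) (j + 1) * x (i, false)

variable {r m y} {x : GammaVertex r → PowerSeries K}

theorem IsGammaSolution.apply_true (hx : IsGammaSolution r m y x) (j : Fin (r + 1)) :
    x (j, true) = x (j, false) + (if exitSide r m (j + 1) = true then descent m y x j else 0) +
      if j = 0 then 1 else 0 := by
  conv_lhs => rw [hx (j, true)]
  simp only [gammaGraph_apply, Fintype.sum_prod_type, Fintype.sum_bool, gammaOne]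
  simp [add_mul, Finset.sum_add_distrib, descent, eq_comm (a := true)]

theorem IsGammaSolution.apply_false (hx : IsGammaSolution r m y x) (j : Fin (r + 1)) :
    x (j, false) = PowerSeries.X * PowerSeries.C (y (2 * ((j : ℕ) + 1) - 1)) * x (j, true) +
      arrival m x j + if exitSide r m (j + 1) = false then descent m y x j else 0 := by
  conv_lhs => rw [hx (j, false)]
  rw [arrival, descent, Fintype.sum_prod_type]
  have h : ∀ i : Fin (r + 1), ∑ a, gammaGraph r m y (i, a) (j, false) * x (i, a) =
      (if i = j then PowerSeries.X * PowerSeries.C (y (2 * ((j : ℕ) + 1) - 1)) * x (i, true)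
        else 0) +
      (if (j : ℕ) = i + 1 then x (i, exitSide r m (i + 1)) else 0) +
      if exitSide r m (j + 1) = false then
        descendingWeight m y (i + 1) (j + 1) * x (i, false) else 0 := by
    intro i
    simp only [gammaGraph_apply, Fintype.sum_bool]
    cases exitSide r m (i + 1) <;> cases exitSide r m (j + 1) <;>
      (simp [add_mul]; try ring)
  simp only [h, Finset.sum_add_distrib, gammaOne]
  simp

/-- The solution of the linear system of `Γ'_m` obtained from a solution for `Γ_m`. -/
noncomputable def compactSolution (m : ℕ → ℤ) (y : ℕ → K) (x : GammaVertex r → PowerSeries K)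
    (j : Fin (r + 1)) : PowerSeries K :=
  verticalLoopProduct r m y j * if j = 0 then x (0, true) else x (j, false)

theorem arrival_zero : arrival m x 0 = 0 := by
  simp [arrival]

theorem arrival_of_val_eq_succ {i j : Fin (r + 1)} (h : (j : ℕ) = i + 1) :
    arrival m x j = x (i, exitSide r m (i + 1)) := by
  rw [arrival, Finset.sum_eq_single i, if_pos h]
  · intro k _ hk
    rw [if_neg fun hc => hk (Fin.ext (by omega))]
  · simp

theorem exitSide_eq_true {J : ℕ} (h : IsVerticalPair r m J) : exitSide r m J = true := by
  simp [exitSide, h]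

theorem exitSide_eq_false {j : Fin (r + 1)} (h : ¬ IsVerticalPair r m (j + 1)) (hj : j ≠ 0) :
    exitSide r m (j + 1) = false := by
  simp [exitSide, h, hj]

theorem not_isVerticalPair_one : ¬ IsVerticalPair r m 1 := fun h => by
  have := h.1
  omega

/-- The ascending edges of `Γ'_m` reproduce, up to the factor `verticalLoopProduct`, the upward
steps of `Γ_m` into each pair. -/
theorem IsGammaSolution.sum_chainWeight (hx : IsGammaSolution r m y x) (j : Fin (r + 1)) :
    ∑ i : Fin (r + 1), chainWeight (PowerSeries K) r m (i + 1) (j + 1) * compactSolution m y x i =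
      verticalLoopProduct r m y j * arrival m x j := by
  obtain ⟨j, hj⟩ := j
  induction j with
  | zero =>
    rw [Finset.sum_eq_zero]
    · rw [show (⟨0, hj⟩ : Fin (r + 1)) = 0 from rfl, arrival_zero, mul_zero]
    · intro i _
      rw [chainWeight_of_le (by simp), zero_mul]
  | succ k ih =>
    have hk : k < r + 1 := by omega
    have ihk := ih hk
    rw [arrival_of_val_eq_succ (i := ⟨k, hk⟩) rfl]
    dsimp only at ihk ⊢
    have hP : verticalLoopProduct r m y (k + 1) = verticalLoopProduct r m y k * _ :=
      Finset.prod_range_succ _ _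
    have hfirst : ∑ i : Fin (r + 1), (if (i : ℕ) + 1 = k + 1 then (1 : PowerSeries K) else 0) *
        compactSolution m y x i = compactSolution m y x ⟨k, hk⟩ := by
      rw [Finset.sum_eq_single ⟨k, hk⟩]
      · simp
      · intro i _ hi
        rw [if_neg fun hc => hi (Fin.ext (by simpa using hc)), zero_mul]
      · simp
    simp only [chainWeight_succ r m _ (k + 1), sub_mul, Finset.sum_sub_distrib]
    rw [hfirst, hP, compactSolution]
    by_cases hv : IsVerticalPair r m (k + 1)
    · have hk0 : (⟨k, hk⟩ : Fin (r + 1)) ≠ 0 := by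
        rintro h
        have h0 : k = 0 := congrArg Fin.val h
        subst h0
        exact not_isVerticalPair_one hv
      simp only [if_pos hv, if_neg hk0]
      -- Removing what has just arrived from below leaves the loop term, whose weight is the new
      -- factor of `verticalLoopProduct`.
      rw [ihk, hx.apply_false]
      simp only [exitSide_eq_true hv]
      simp
      ring
    · simp only [if_neg hv, zero_mul, Finset.sum_const_zero, sub_zero, mul_one]
      split_ifs with h
      -- The bottom pair is left from its upper vertex although it is not vertical, hence the
      -- special value of `compactSolution` there.
      · have h0 : k = 0 := congrArg Fin.val h
        subst h0
        simp [exitSide]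
      · rw [exitSide_eq_false (j := ⟨k, hk⟩) hv h]

open Classical in
-- The additional loop factor at a vertical target reflects that descending edges land on `J⁺`,
-- while `compactSolution` records `J⁻`.
theorem sum_descendingWeight_mul_compactSolution (j : Fin (r + 1)) :
    ∑ i : Fin (r + 1), descendingWeight m y (i + 1) (j + 1) * compactSolution m y x i =
      verticalLoopProduct r m y j * (if IsVerticalPair r m (j + 1) then
        PowerSeries.X * PowerSeries.C (y (2 * ((j : ℕ) + 1) - 1)) else 1) * descent m y x j := by
  rw [descent, Finset.mul_sum]
  refine Finset.sum_congr rfl fun i _ => ?_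
  rw [compactSolution, ← mul_assoc, descendingWeight_mul_verticalLoopProduct, mul_assoc,
    mul_assoc]
  -- The exceptional value at the bottom pair is harmless: no descending edge starts there.
  by_cases h : i = 0
  · subst h
    rw [descendingWeight_of_le m y (by simp)]
    simp
  · rw [if_neg h, mul_assoc]

theorem IsGammaSolution.compactSolution_eq (hx : IsGammaSolution r m y x) (j : Fin (r + 1)) :
    compactSolution m y x j = ∑ i, compactGraph r m y i j * compactSolution m y x i +
      if j = 0 then 1 else 0 := by
  simp only [compactGraph_apply, add_mul, Finset.sum_add_distrib, ite_mul, zero_mul,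
    Finset.sum_ite_eq', Finset.mem_univ, if_true]
  rw [hx.sum_chainWeight, sum_descendingWeight_mul_compactSolution, compactSolution]
  have ht := hx.apply_true j
  have hf := hx.apply_false j
  by_cases hj : j = 0
  · subst hj
    have he : exitSide r m (((0 : Fin (r + 1)) : ℕ) + 1) = true := by simp [exitSide]
    have hv : ¬ IsVerticalPair r m (((0 : Fin (r + 1)) : ℕ) + 1) := not_isVerticalPair_one
    rw [he] at ht hf
    rw [if_neg hv]
    simp only [arrival_zero, verticalLoopProduct, Fin.val_zero,
      Finset.prod_range_zero, if_true] at ht hf ⊢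
    simp only [Bool.true_eq_false, if_false] at hf
    -- Here `x (1⁻)` is eliminated; at every other pair it is `x (J⁺)`.
    linear_combination ht + hf
  · by_cases hv : IsVerticalPair r m (j + 1)
    · rw [exitSide_eq_true hv] at ht hf
      simp only [if_neg hj, if_pos hv, if_true, Bool.true_eq_false, if_false] at ht hf ⊢
      linear_combination verticalLoopProduct r m y j * hf + verticalLoopProduct r m y j *
        (PowerSeries.X * PowerSeries.C (y (2 * ((j : ℕ) + 1) - 1))) * ht
    · rw [exitSide_eq_false hv hj] at ht hf
      simp only [if_neg hj, if_neg hv, if_true, Bool.false_eq_true, if_false] at ht hf ⊢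
      linear_combination verticalLoopProduct r m y j * hf + verticalLoopProduct r m y j *
        (PowerSeries.X * PowerSeries.C (y (2 * ((j : ℕ) + 1) - 1))) * ht

end Comparison

theorem compactificationPreservesPaths {K : Type*} [Field K] (r : ℕ) (m : ℕ → ℤ) (y : ℕ → K) :
    CompactificationPreservesPaths r m y := by
  have hG := rank_lt_of_constantCoeff_gammaGraph_ne_zero r m y
  have hC := lt_of_constantCoeff_compactGraph_ne_zero r m y
  have hu := isUnit_one_sub_transferMatrix _ _ hG
  have hu' := isUnit_one_sub_transferMatrix _ _ hC
  refine ⟨hu, hu', ?_, isPathGenFun_inv_one_sub _ _ hG _ _, isPathGenFun_inv_one_sub _ _ hC _ _⟩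
  have hx : IsGammaSolution r m y fun v =>
      (1 - transferMatrix (gammaGraph r m y))⁻¹ v (gammaOne r) := fun v =>
    inv_one_sub_transferMatrix_apply _ hu _ v
  rw [inv_one_sub_transferMatrix_apply_eq _ hu' 0 _ hx.compactSolution_eq 0]
  simp [compactSolution, verticalLoopProduct, gammaOne]

theorem mainTheorem4 {K : Type*} [Field K] (r : ℕ) (hr : 1 ≤ r)
    (m : ℕ → ℤ) (hm : IsMotzkinPath r m) :
    -- arbitrary skeleton weights for which the weights of the extra edges make sense
    (∀ y : ℕ → K, (∀ j : ℕ, 2 ≤ j → j ≤ r → y (2 * j - 1) ≠ 0) →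
      CompactificationPreservesPaths r m y) ∧
    -- the skeleton weights attached to a solution of the `Q`-system
    (∀ R : ℕ → ℤ → K, IsQSystemSolution r R →
      (∀ (α : ℕ) (n : ℤ), 1 ≤ α → α ≤ r → R α n ≠ 0) →
      CompactificationPreservesPaths r m (skeletonWeight R m)) := by
  exact ⟨fun y _ => compactificationPreservesPaths r m y,
    fun R _ _ => compactificationPreservesPaths r m (skeletonWeight R m)⟩
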